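/- Let $\vec m=(m_k)_{k\ge 1}$ be a strictly increasing sequence of positive integers with $m_1=1$. For positive integers $j,j'$ write $j'\prec j$ if there is some $k\ge 1$ with $j'<m_k\le j$. Let $\mathcal S_{\vec m}$ be the monoid with the presentation $$\mathcal S_{\vec m}=\left\langle x,y \;\middle|\; x^2=x,\ \ xy^{j}xy^{j'}x=xy^{j}x\ \text{ for all } j,j'\ge 1 \text{ with } j'\prec j\right\rangle .$$ For $a\in\mathcal S_{\vec m}$ let $|a|$ be the word length of $a$ with respect to $\{x,y\}$, that is, the least $k\ge 0$ such that $a$ is a product of $k$ elements of $\{x,y\}$. Let $R_n=X_1X_2\cdots X_n$ ($n\ge 0$) be the simple random walk on $\mathcal S_{\vec m}$, where $X_1,X_2,\dots$ are independent and uniformly distributed on $\{x,y\}$. Then for every $n\ge 0$ the expectation $\mathbb E|R_n|$ is finite and $$\sum_{k\ge 1:\ m_k\le n-2}\frac{m_k+1}{2^{m_k+3}}\min\{2^{m_{k+1}},n\}\ \le\ \mathbb E|R_n|\ \le\ \sum_{k\ge 1:\ m_k\le n-2}\frac{m_k+2}{2^{m_k}}\min\{2^{m_{k+1}},n\}+3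 .$$ -/

import Mathlib

open MeasureTheory ProbabilityTheory

/-- The length of an element `a` of a monoid with respect to a generating set `T`: the least `k`
such that `a` is a product of `k` elements of `T`. -/
noncomputable def wordLength {M : Type*} [Monoid M] (T : Set M) (a : M) : ℕ :=
  sInf {k : ℕ | ∃ l : List M, l.length = k ∧ (∀ t ∈ l, t ∈ T) ∧ l.prod = a}

/-- `R` is a simple (right) random walk on the monoid `M` with respect to the finite generating
set `T`: `R n = X₁ ⋯ Xₙ` where the steps are independent and uniformly distributed on `T`
(the step `X i` below is the `(i + 1)`-st one). The monoid is meant to be discrete. -/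
def IsSimpleRandomWalk {M : Type*} [Monoid M] [MeasurableSpace M] (T : Set M)
    {Ω : Type*} [MeasurableSpace Ω] (μ : Measure Ω) (R : ℕ → Ω → M) : Prop :=
  ∃ X : ℕ → Ω → M, iIndepFun X μ ∧ (∀ i, HasLaw (X i) (uniformOn T) μ) ∧
    ∀ n ω, R n ω = ((List.range n).map fun i => X i ω).prod

/-- The two letters of the alphabet. -/
inductive Letter where
  | x
  | y

/-- For a sequence `m 1 < m 2 < ⋯`, the relation `j' ≺ j`: some `m k` with `k ≥ 1` separates `j'`
from `j`. The value `m 0` is never used. -/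
def Prec (m : ℕ → ℕ) (j' j : ℕ) : Prop :=
  ∃ k, 1 ≤ k ∧ j' < m k ∧ m k ≤ j

/-- The defining relations of `S_m`: `x ^ 2 = x`, and `x y ^ j x y ^ j' x = x y ^ j x` whenever
`j, j' ≥ 1` and `j' ≺ j`. -/
inductive SmRel (m : ℕ → ℕ) : FreeMonoid Letter → FreeMonoid Letter → Prop
  | idem : SmRel m (FreeMonoid.of Letter.x ^ 2) (FreeMonoid.of Letter.x)
  | absorb (j j' : ℕ) (hj : 1 ≤ j) (hj' : 1 ≤ j') (h : Prec m j' j) :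
      SmRel m
        (FreeMonoid.of Letter.x * FreeMonoid.of Letter.y ^ j * FreeMonoid.of Letter.x *
          FreeMonoid.of Letter.y ^ j' * FreeMonoid.of Letter.x)
        (FreeMonoid.of Letter.x * FreeMonoid.of Letter.y ^ j * FreeMonoid.of Letter.x)

/-- The semigroup (with identity) `S_m`. -/
def Sm (m : ℕ → ℕ) : Type := PresentedMonoid (SmRel m)

namespace Sm

instance (m : ℕ → ℕ) : Monoid (Sm m) := inferInstanceAs (Monoid (PresentedMonoid (SmRel m)))

/-- `S_m` is countable and carries the discrete σ-algebra. -/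
instance (m : ℕ → ℕ) : MeasurableSpace (Sm m) := ⊤

/-- The generator `x`. -/
def x (m : ℕ → ℕ) : Sm m := PresentedMonoid.of (SmRel m) Letter.x

/-- The generator `y`. -/
def y (m : ℕ → ℕ) : Sm m := PresentedMonoid.of (SmRel m) Letter.y

/-- The generating set `{x, y}`. -/
def gens (m : ℕ → ℕ) : Set (Sm m) := {x m, y m}

end Sm

/-- The (finite) set of the indices `k ≥ 1` with `m k ≤ n - 2`, for `m 1 < m 2 < ⋯`. -/
def smallIndices (m : ℕ → ℕ) (n : ℕ) : Finset ℕ :=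
  (Finset.Icc 1 n).filter fun k => m k + 2 ≤ n

/-- The bound `k ≤ n` in `smallIndices` loses nothing. -/
theorem mem_smallIndices {m : ℕ → ℕ} (hm1 : m 1 = 1) (hm : ∀ k, 1 ≤ k → m k < m (k + 1))
    (n k : ℕ) : k ∈ smallIndices m n ↔ 1 ≤ k ∧ m k + 2 ≤ n := by
  have hk : ∀ k, 1 ≤ k → k ≤ m k := by
    intro k h
    induction k, h using Nat.le_induction with
    | base => omega
    | succ k h ih => have := hm k h; omega
  simp only [smallIndices, Finset.mem_filter, Finset.mem_Icc]
  constructor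
  · rintro ⟨⟨h1, _⟩, h3⟩
    exact ⟨h1, h3⟩
  · rintro ⟨h1, h3⟩
    have := hk k h1
    exact ⟨⟨h1, by omega⟩, h3⟩

/-! A finite record suffices to compute lengths in `S_m`. A run of `y`s closed by an `x` is erased
exactly when it is `≺` the last run kept, so the levels of the kept runs never decrease and the last
one stands for all of them. Reading respects the relations, so it is an action of the monoid
(`act`). A letter lengthens the record by at most one, and the record is spelled by an actual word,
so its size is the word length (`wordLength_eq_size`).

The expectation then has an exact formula (`avg_size`). Apart from the initial `y`s and the current
run, which contribute `3 - (n + 3) / 2 ^ n`, a run of length `j` adds `j + 1` when it is closed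
while the last kept run is below the next threshold `T = next j`. Runs of length `j` begin at an `x`
and cost a factor `2 ^ (-j)`, so everything reduces to `visits N T`.

`visits` is controlled by a feedback identity: the probability of being blocked by a run of length
`T` is `visits / 2 ^ T` (`blocked_eq_visits`). As a probability it gives `visits ≤ 2 ^ T`; trivially
`visits ≤ N / 2`; and reinserting the latter shows that blocking has probability at most `1/2` up to
time `2 ^ T`, whence `visits ≥ min (2 ^ T) N / 4`. Grouping all `j` by level gives the upper bound;
keeping only `j = m k` gives the lower one. -/

/-- What a left-to-right reader of a word in `x` and `y` has to remember in order to compute the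
length of its normal form in `S_m`: whether an `x` has been read, the length of the normal form
without its final run of `y`s, the length of the last run of `y`s kept between two `x`s (`0` if
there is none), and the length of the current run of `y`s. -/
@[ext] structure ReadState where
  started : Bool
  kept : ℕ
  top : ℕ
  run : ℕ

namespace ReadState

/-- The state before anything is read. -/
def init : ReadState := ⟨false, 0, 0, 0⟩

/-- The length of the normal form. -/
def size (s : ReadState) : ℕ := s.kept + s.run

/-- Reading `y`. -/
def stepY (s : ReadState) : ReadState := ⟨s.started, s.kept, s.top, s.run + 1⟩

open Classical in
/-- Reading `x`. -/
noncomputable def stepX (m : ℕ → ℕ) (s : ReadState) : ReadState :=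
  if s.started = false then ⟨true, s.kept + s.run + 1, 0, 0⟩
  else if s.run = 0 ∨ Prec m s.run s.top then ⟨true, s.kept, s.top, 0⟩
  else ⟨true, s.kept + s.run + 1, s.run, 0⟩

/-- Reading a letter. -/
noncomputable def step (m : ℕ → ℕ) : Letter → ReadState → ReadState
  | Letter.x => stepX m
  | Letter.y => stepY

theorem iterate_stepY (s : ReadState) (j : ℕ) :
    stepY^[j] s = ⟨s.started, s.kept, s.top, s.run + j⟩ := by
  induction j generalizing s with
  | zero => rfl
  | succ j ih =>
    rw [Function.iterate_succ_apply, ih]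
    simp [stepY, add_assoc, add_comm 1 j]

theorem stepX_started (m : ℕ → ℕ) (s : ReadState) : (stepX m s).started = true := by
  unfold stepX; split_ifs <;> rfl

theorem stepX_run (m : ℕ → ℕ) (s : ReadState) : (stepX m s).run = 0 := by
  unfold stepX; split_ifs <;> rfl

theorem stepX_of_run_eq_zero (m : ℕ → ℕ) {s : ReadState} (h : s.started = true)
    (h0 : s.run = 0) : stepX m s = s := by
  ext <;> simp [stepX, h, h0]

theorem stepX_of_prec (m : ℕ → ℕ) {s : ReadState} (h : s.started = true)
    (hp : Prec m s.run s.top) : stepX m s = ⟨true, s.kept, s.top, 0⟩ := by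
  simp [stepX, h, hp]

theorem size_stepX_le (m : ℕ → ℕ) (s : ReadState) : (stepX m s).size ≤ s.size + 1 := by
  unfold stepX size; split_ifs <;> simp only <;> omega

theorem size_step_le (m : ℕ → ℕ) (c : Letter) (s : ReadState) :
    (step m c s).size ≤ s.size + 1 := by
  cases c
  · exact size_stepX_le m s
  · exact le_of_eq rfl

/-- Once a run of length `j` is read between two `x`s, runs of a lower level are below the last run kept. -/
theorem prec_top_of_prec (m : ℕ → ℕ) {s : ReadState} (h : s.started = true) {j' : ℕ}
    (hp : Prec m j' s.run) : Prec m j' (stepX m s).top := by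
  unfold stepX
  rw [if_neg (by simp [h])]
  split_ifs with h1
  · rcases h1 with h1 | ⟨k, hk, h1, h2⟩
    · obtain ⟨k, hk, h2, h3⟩ := hp
      omega
    · obtain ⟨k', hk', h3, h4⟩ := hp
      exact ⟨k', hk', h3, by simp only; omega⟩
  · exact hp

end ReadState

/-! ### Word length in `S_m` as the size of the reader's state -/

namespace Sm

open ReadState

/-- The image in `S_m` of a letter. -/
def gen (m : ℕ → ℕ) : Letter → Sm m := PresentedMonoid.of (SmRel m)

/-- Reading a letter, as an element of the monoid of right actions on the states. -/
noncomputable def readLetter (m : ℕ → ℕ) (c : Letter) : (Function.End ReadState)ᵐᵒᵖ :=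
  MulOpposite.op (step m c)

theorem lift_step_pow_y (m : ℕ → ℕ) (j : ℕ) :
    (FreeMonoid.lift (readLetter m) (FreeMonoid.of Letter.y ^ j)).unop = stepY^[j] := by
  rw [map_pow, FreeMonoid.lift_eval_of]
  induction j with
  | zero => rfl
  | succ j ih =>
    rw [pow_succ, MulOpposite.unop_mul, ih, Function.iterate_succ']
    rfl

/-- The relations hold on every state, reachable or not. After an `x` the run is empty, so a second
`x` does nothing; after `x y ^ j x` the last kept run is at least of the level of `j`, so a later
run `j' ≺ j` is erased. -/
theorem lift_step_eq_of_rel (m : ℕ → ℕ) (a b : FreeMonoid Letter) (h : SmRel m a b) :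
    FreeMonoid.lift (readLetter m) a =
      FreeMonoid.lift (readLetter m) b := by
  induction h with
  | idem =>
    rw [pow_two, map_mul, FreeMonoid.lift_eval_of]
    apply MulOpposite.unop_injective
    funext s
    exact stepX_of_run_eq_zero m (stepX_started m s) (stepX_run m s)
  | absorb j j' hj hj' h =>
    apply MulOpposite.unop_injective
    simp only [map_mul, MulOpposite.unop_mul, lift_step_pow_y, FreeMonoid.lift_eval_of]
    funext s
    change stepX m (stepY^[j'] (stepX m (stepY^[j] (stepX m s)))) =
      stepX m (stepY^[j] (stepX m s))
    generalize hu : stepY^[j] (stepX m s) = u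
    have hus : u.started = true := by rw [← hu, iterate_stepY]; exact stepX_started m s
    have hur : u.run = j := by rw [← hu, iterate_stepY]; simp [stepX_run]
    have hp : Prec m j' (stepX m u).top := prec_top_of_prec m hus (by rwa [hur])
    rw [iterate_stepY, stepX_of_prec]
    · ext
      · exact (stepX_started m u).symm
      · rfl
      · rfl
      · exact (stepX_run m u).symm
    · exact stepX_started m u
    · simpa [stepX_run] using hp

/-- The right action of `S_m` on the reader's states. -/
noncomputable def act (m : ℕ → ℕ) : Sm m →* (Function.End ReadState)ᵐᵒᵖ :=
  PresentedMonoid.lift (readLetter m)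
    (lift_step_eq_of_rel m)

/-- The state of the reader after reading an element of `S_m`. -/
noncomputable def state (m : ℕ → ℕ) (a : Sm m) : ReadState := (act m a).unop init

theorem state_one (m : ℕ → ℕ) : state m 1 = init := by
  simp only [state, map_one]; rfl

theorem act_gen (m : ℕ → ℕ) (c : Letter) :
    act m (gen m c) = readLetter m c :=
  rfl

theorem state_mul_gen (m : ℕ → ℕ) (a : Sm m) (c : Letter) :
    state m (a * gen m c) = step m c (state m a) := by
  simp only [state, map_mul, act_gen]; rfl

theorem x_ne_y (m : ℕ → ℕ) : x m ≠ y m := by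
  intro h
  have h1 := state_mul_gen m 1 Letter.x
  have h2 := state_mul_gen m 1 Letter.y
  change state m (1 * x m) = _ at h1
  change state m (1 * y m) = _ at h2
  rw [h, h2, state_one] at h1
  have := congrArg ReadState.started h1
  simp [step, stepX, stepY, init] at this

theorem size_state_prod_le (m : ℕ → ℕ) (l : List (Sm m)) (hl : ∀ t ∈ l, t ∈ gens m) :
    (state m l.prod).size ≤ l.length := by
  induction l using List.reverseRecOn with
  | nil => simp [state_one, init, size]
  | append_singleton l t ih =>
    have h1 := ih fun t ht => hl t (by simp [ht])
    have h2 : ∃ c, t = gen m c := by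
      rcases hl t (by simp) with h | h
      · exact ⟨Letter.x, h⟩
      · exact ⟨Letter.y, h⟩
    obtain ⟨c, rfl⟩ := h2
    rw [List.prod_append, List.prod_singleton, state_mul_gen, List.length_append,
      List.length_singleton]
    exact (size_step_le m c _).trans (by omega)

theorem x_mul_x (m : ℕ → ℕ) : x m * x m = x m := by
  have h := PresentedMonoid.mk_eq_mk_of_rel (SmRel.idem (m := m))
  rw [pow_two] at h
  exact h

theorem x_y_x_y_x (m : ℕ → ℕ) {j j' : ℕ} (hj : 1 ≤ j) (hj' : 1 ≤ j') (h : Prec m j' j) :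
    x m * y m ^ j * x m * y m ^ j' * x m = x m * y m ^ j * x m :=
  PresentedMonoid.mk_eq_mk_of_rel (SmRel.absorb j j' hj hj' h)

/-- The element `a` is represented by a word as described by the state `s`. -/
def Represents (m : ℕ → ℕ) (s : ReadState) (a : Sm m) : Prop :=
  (s.started = false ∧ s.kept = 0 ∧ a = y m ^ s.run) ∨
  (s.started = true ∧ ∃ l : List (Sm m), l.length = s.kept ∧ (∀ t ∈ l, t ∈ gens m) ∧
    a = l.prod * y m ^ s.run ∧ l.prod * x m = l.prod ∧
    ∀ j', 1 ≤ j' → Prec m j' s.top → l.prod * y m ^ j' * x m = l.prod)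

theorem Represents.mul_y {m : ℕ → ℕ} {s : ReadState} {a : Sm m} (h : Represents m s a) :
    Represents m (stepY s) (a * y m) := by
  rcases h with ⟨h1, h2, rfl⟩ | ⟨h1, l, h2, h3, rfl, h5, h6⟩
  · exact Or.inl ⟨h1, h2, (pow_succ _ _).symm⟩
  · exact Or.inr ⟨h1, l, h2, h3, by rw [mul_assoc, ← pow_succ]; rfl, h5, h6⟩

theorem Represents.mul_x {m : ℕ → ℕ} {s : ReadState} {a : Sm m} (h : Represents m s a) :
    Represents m (stepX m s) (a * x m) := by
  have hx : x m ∈ gens m := Or.inl rfl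
  have hy : y m ∈ gens m := Or.inr rfl
  have hr : ∀ n, ∀ t ∈ List.replicate n (y m), t ∈ gens m := fun n t ht => by
    rw [List.eq_of_mem_replicate ht]; exact hy
  unfold stepX
  rcases h with ⟨h1, h2, rfl⟩ | ⟨h1, l, h2, h3, rfl, h5, h6⟩
  · rw [if_pos h1]
    refine Or.inr ⟨rfl, List.replicate s.run (y m) ++ [x m], by simp [h2], ?_, by simp, ?_, ?_⟩
    · intro t ht
      rcases List.mem_append.1 ht with ht | ht
      · exact hr _ t ht
      · rw [List.mem_singleton.1 ht]; exact hx
    · simp [mul_assoc, x_mul_x]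
    -- With no run kept, `top = 0`, and nothing is `≺ 0`.
    · rintro j' - ⟨k, -, h3, h4⟩
      simp only at h4
      omega
  · rw [if_neg (by simp [h1])]
    split_ifs with hc
    · refine Or.inr ⟨rfl, l, h2, h3, ?_, h5, h6⟩
      rw [pow_zero, mul_one]
      rcases Nat.eq_zero_or_pos s.run with h0 | h0
      · rw [h0, pow_zero, mul_one, h5]
      · exact h6 _ h0 (hc.resolve_left (by omega))
    · rw [not_or] at hc
      have hp : (l ++ List.replicate s.run (y m) ++ [x m]).prod = l.prod * y m ^ s.run * x m := by
        simp [mul_assoc]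
      refine Or.inr ⟨rfl, l ++ List.replicate s.run (y m) ++ [x m], by simp [h2]; omega, ?_,
        by rw [hp, pow_zero, mul_one], ?_, ?_⟩
      · intro t ht
        rcases List.mem_append.1 ht with ht | ht
        · rcases List.mem_append.1 ht with ht | ht
          · exact h3 t ht
          · exact hr _ t ht
        · rw [List.mem_singleton.1 ht]; exact hx
      · rw [hp, mul_assoc, x_mul_x]
      · intro j' hj' hp'
        have h := x_y_x_y_x m (Nat.one_le_iff_ne_zero.2 hc.1) hj' hp'
        -- The defining relation begins with `x`; it is supplied by `l.prod = l.prod * x`.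
        rw [hp, ← h5]
        simp only [mul_assoc] at h ⊢
        rw [h]

theorem exists_word (m : ℕ → ℕ) (a : Sm m) : ∃ l : List Letter, a = (l.map (gen m)).prod := by
  induction a using PresentedMonoid.inductionOn with
  | _ w =>
  induction w using FreeMonoid.inductionOn' with
  | one => exact ⟨[], rfl⟩
  | of_mul b w ih =>
    obtain ⟨l, hl⟩ := ih
    refine ⟨b :: l, ?_⟩
    rw [map_mul, hl, List.map_cons, List.prod_cons]
    rfl

theorem represents_state (m : ℕ → ℕ) (a : Sm m) : Represents m (state m a) a := by
  obtain ⟨l, rfl⟩ := exists_word m a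
  induction l using List.reverseRecOn with
  | nil =>
    rw [List.map_nil, List.prod_nil, state_one]
    exact Or.inl ⟨rfl, rfl, (pow_zero _).symm⟩
  | append_singleton l c ih =>
    rw [List.map_append, List.prod_append, List.map_singleton, List.prod_singleton, state_mul_gen]
    cases c
    · exact ih.mul_x
    · exact ih.mul_y

/-- The upper bound is the word given by `Represents`. For the lower bound, the state depends only
on the element, so any word spelling it has at least `size` letters. -/
theorem wordLength_eq_size (m : ℕ → ℕ) (a : Sm m) :
    wordLength (gens m) a = (state m a).size := by
  have hr : ∀ n, ∀ t ∈ List.replicate n (y m), t ∈ gens m := fun n t ht => by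
    rw [List.eq_of_mem_replicate ht]; exact Or.inr rfl
  have hmem : (state m a).size ∈
      {k : ℕ | ∃ l : List (Sm m), l.length = k ∧ (∀ t ∈ l, t ∈ gens m) ∧ l.prod = a} := by
    rcases represents_state m a with ⟨-, h2, h3⟩ | ⟨-, l, h2, h3, h4, -⟩
    · exact ⟨List.replicate (state m a).run (y m), by simp [size, h2], hr _,
        by rw [List.prod_replicate, ← h3]⟩
    · refine ⟨l ++ List.replicate (state m a).run (y m), by simp [size, h2], fun t ht => ?_, ?_⟩
      · rcases List.mem_append.1 ht with ht | ht
        · exact h3 t ht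
        · exact hr _ t ht
      · rw [List.prod_append, List.prod_replicate, ← h4]
  refine le_antisymm (Nat.sInf_le hmem) ?_
  obtain ⟨l, h1, h2, h3⟩ := Nat.sInf_mem ⟨_, hmem⟩
  unfold wordLength
  rw [← h1]
  conv_lhs => rw [← h3]
  exact size_state_prod_le m l h2

end Sm

/-! ### Averages over random words, and first passage to a long run -/

namespace Sm

open ReadState

/-- The average of `g` over the states of the reader after reading a uniformly random word of
length `n`. -/
noncomputable def avg (m : ℕ → ℕ) : ℕ → (ReadState → ℝ) → ℝ
  | 0, g => g init
  | n + 1, g => avg m n fun s => (g (stepX m s) + g (stepY s)) / 2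

theorem avg_succ (m : ℕ → ℕ) (n : ℕ) (g : ReadState → ℝ) :
    avg m (n + 1) g = avg m n fun s => (g (stepX m s) + g (stepY s)) / 2 := rfl

theorem avg_add (m : ℕ → ℕ) (n : ℕ) (f g : ReadState → ℝ) :
    avg m n (fun s => f s + g s) = avg m n f + avg m n g := by
  induction n generalizing f g with
  | zero => rfl
  | succ n ih =>
    simp only [avg_succ, ← ih]
    congr 1; funext s; ring

theorem avg_const_mul (m : ℕ → ℕ) (n : ℕ) (c : ℝ) (f : ReadState → ℝ) :
    avg m n (fun s => c * f s) = c * avg m n f := by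
  induction n generalizing f with
  | zero => rfl
  | succ n ih =>
    simp only [avg_succ, ← ih]
    congr 1; funext s; ring

theorem avg_const (m : ℕ → ℕ) (n : ℕ) (c : ℝ) : avg m n (fun _ => c) = c := by
  induction n with
  | zero => rfl
  | succ n ih =>
    rw [avg_succ]
    conv_rhs => rw [← ih]
    congr 1; funext s; ring

theorem avg_sum (m : ℕ → ℕ) (n : ℕ) {ι : Type*} (S : Finset ι) (f : ι → ReadState → ℝ) :
    avg m n (fun s => ∑ i ∈ S, f i s) = ∑ i ∈ S, avg m n (f i) := by
  classical
  induction S using Finset.induction_on with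
  | empty => simpa using avg_const m n 0
  | insert a S ha ih => simp only [Finset.sum_insert ha, avg_add, ih]

/-- Only states reachable in `n` letters matter; the bound on `run` lets a sum over `Icc 1 n` see
every nonempty run. -/
theorem avg_congr (m : ℕ → ℕ) (n : ℕ) {f g : ReadState → ℝ}
    (h : ∀ s : ReadState, s.run ≤ n → f s = g s) : avg m n f = avg m n g := by
  induction n generalizing f g with
  | zero => exact h _ le_rfl
  | succ n ih =>
    refine ih fun s hs => ?_
    rw [h _ (by rw [stepX_run]; omega), h (stepY s) (by simp only [stepY]; omega)]

theorem avg_mono (m : ℕ → ℕ) (n : ℕ) {f g : ReadState → ℝ} (h : ∀ s, f s ≤ g s) :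
    avg m n f ≤ avg m n g := by
  induction n generalizing f g with
  | zero => exact h _
  | succ n ih =>
    refine ih fun s => ?_
    have := h (stepX m s)
    have := h (stepY s)
    linarith

/-- The probability that after `n` letters an `x` has been read, the current run of `y`s has length
`j`, and the last run kept is shorter than `T`. -/
noncomputable def freeRun (m : ℕ → ℕ) (n j T : ℕ) : ℝ :=
  avg m n fun s => if s.started = true ∧ s.run = j ∧ s.top < T then 1 else 0

/-- The probability that after `n` letters an `x` has been read and a run of `T` or more `y`s has
been kept or is being read. -/
noncomputable def blocked (m : ℕ → ℕ) (n T : ℕ) : ℝ :=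
  avg m n fun s => if s.started = true ∧ (T ≤ s.top ∨ T ≤ s.run) then 1 else 0

theorem freeRun_nonneg (m : ℕ → ℕ) (n j T : ℕ) : 0 ≤ freeRun m n j T := by
  rw [← avg_const m n 0]
  refine avg_mono m n fun s => ?_
  split_ifs <;> norm_num

theorem blocked_nonneg (m : ℕ → ℕ) (n T : ℕ) : 0 ≤ blocked m n T := by
  rw [← avg_const m n 0]
  refine avg_mono m n fun s => ?_
  split_ifs <;> norm_num

theorem blocked_le_one (m : ℕ → ℕ) (n T : ℕ) : blocked m n T ≤ 1 := by
  rw [← avg_const m n 1]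
  refine avg_mono m n fun s => ?_
  split_ifs <;> norm_num

theorem freeRun_zero (m : ℕ → ℕ) (j T : ℕ) : freeRun m 0 j T = 0 := by
  simp [freeRun, avg, init]

theorem freeRun_succ_succ (m : ℕ → ℕ) (n j T : ℕ) :
    freeRun m (n + 1) (j + 1) T = freeRun m n j T / 2 := by
  rw [freeRun, avg_succ, freeRun, div_eq_inv_mul, ← avg_const_mul]
  congr 1; funext s
  rw [if_neg (by rw [stepX_run]; omega)]
  simp only [stepY, Nat.add_right_cancel_iff]
  ring

theorem freeRun_add (m : ℕ → ℕ) (i j T : ℕ) :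
    freeRun m (i + j) j T = freeRun m i 0 T / 2 ^ j := by
  induction j with
  | zero => simp
  | succ j ih => rw [← add_assoc, freeRun_succ_succ, ih, pow_succ, div_div]

theorem freeRun_of_le (m : ℕ → ℕ) {n j : ℕ} (h : n ≤ j) (T : ℕ) : freeRun m n j T = 0 := by
  induction n generalizing j with
  | zero => exact freeRun_zero m j T
  | succ n ih =>
    obtain ⟨j, rfl⟩ : ∃ i, j = i + 1 := ⟨j - 1, by omega⟩
    rw [freeRun_succ_succ, ih (by omega), zero_div]

/-- The threshold must be some `m k`: then a run shorter than it is `≺` any kept run that reaches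
it, so `top` cannot fall back below the threshold. Writing it as `t + 1` isolates the `y` that
completes a blocking run. -/
theorem stepX_top_lt_iff {m : ℕ → ℕ} {k t : ℕ} (hk : 1 ≤ k) (ht : m k = t + 1) (s : ReadState) :
    (stepX m s).top < t + 1 ↔ ¬(s.started = true ∧ (t + 1 ≤ s.top ∨ t + 1 ≤ s.run)) := by
  unfold stepX
  split_ifs with h1 h2
  · simp [h1]
  · simp only [Bool.not_eq_false] at h1
    simp only [h1, true_and]
    rcases h2 with h2 | ⟨k', -, h2, h3⟩ <;> omega
  · simp only [Bool.not_eq_false] at h1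
    simp only [h1, true_and]
    have h3 : ¬(s.run < t + 1 ∧ t + 1 ≤ s.top) := fun h =>
      h2 (Or.inr ⟨k, hk, by rw [ht]; exact h.1, by rw [ht]; exact h.2⟩)
    omega

theorem freeRun_succ_zero {m : ℕ → ℕ} {k t : ℕ} (hk : 1 ≤ k) (ht : m k = t + 1) (n : ℕ) :
    freeRun m (n + 1) 0 (t + 1) = (1 - blocked m n (t + 1)) / 2 := by
  have h : freeRun m (n + 1) 0 (t + 1) + 1 / 2 * blocked m n (t + 1) = 1 / 2 := by
    rw [freeRun, avg_succ, blocked, ← avg_const_mul, ← avg_add]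
    conv_rhs => rw [← avg_const m n (1 / 2)]
    congr 1; funext s
    rw [if_neg (c := _ ∧ (stepY s).run = 0 ∧ _) (by simp [stepY])]
    simp only [stepX_started, stepX_run, true_and, stepX_top_lt_iff hk ht, ite_not]
    split_ifs <;> norm_num
  linarith

/-- Blocking is irreversible, and it newly occurs only when a `y` extends a run from `t` to `t + 1`.
-/
theorem blocked_succ {m : ℕ → ℕ} {k t : ℕ} (hk : 1 ≤ k) (ht : m k = t + 1) (n : ℕ) :
    blocked m (n + 1) (t + 1) = blocked m n (t + 1) + freeRun m n t (t + 1) / 2 := by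
  rw [blocked, avg_succ, blocked, freeRun, div_eq_inv_mul, ← avg_const_mul, ← avg_add]
  congr 1; funext s
  have h1 : ((stepX m s).started = true ∧
      (t + 1 ≤ (stepX m s).top ∨ t + 1 ≤ (stepX m s).run)) ↔
      (s.started = true ∧ (t + 1 ≤ s.top ∨ t + 1 ≤ s.run)) := by
    rw [← not_iff_not, ← stepX_top_lt_iff hk ht s, stepX_started, stepX_run]
    simp
  simp only [h1]
  simp only [stepY]
  by_cases hs : s.started = true
  · simp only [hs, true_and]
    split_ifs <;> first | omega | norm_num
  · simp [hs]

/-- The expected number of indices `1 ≤ i ≤ N` such that the `i`-th letter is `x` and no run of `T`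
or more `y`s between two `x`s precedes it. -/
noncomputable def visits (m : ℕ → ℕ) (N T : ℕ) : ℝ :=
  ∑ i ∈ Finset.range N, freeRun m (i + 1) 0 T

/-- A run of length `j` at time `i` comes from an `x` at time `i - j` followed by `j` letters `y`;
the possible times of that `x` are `1, …, n - 1 - j`. -/
theorem sum_freeRun (m : ℕ → ℕ) (n j T : ℕ) :
    ∑ i ∈ Finset.range n, freeRun m i j T = visits m (n - 1 - j) T / 2 ^ j := by
  induction n with
  | zero => simp [visits]
  | succ n ih =>
    rw [Finset.sum_range_succ, ih]
    rcases le_or_gt n j with h | h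
    · rw [freeRun_of_le m h, add_zero, Nat.sub_eq_zero_of_le (by omega),
        Nat.sub_eq_zero_of_le (by omega)]
    · obtain ⟨d, rfl⟩ : ∃ d, n = d + 1 + j := ⟨n - j - 1, by omega⟩
      rw [freeRun_add, show d + 1 + j - 1 - j = d by omega,
        show d + 1 + j + 1 - 1 - j = d + 1 by omega, visits, visits, Finset.sum_range_succ, add_div]

theorem blocked_eq_visits {m : ℕ → ℕ} {k t : ℕ} (hk : 1 ≤ k) (ht : m k = t + 1) (n : ℕ) :
    blocked m n (t + 1) = visits m (n - (t + 1)) (t + 1) / 2 ^ (t + 1) := by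
  have h : blocked m n (t + 1) = (∑ i ∈ Finset.range n, freeRun m i t (t + 1)) / 2 := by
    induction n with
    | zero => simp [blocked, avg, init]
    | succ n ih => rw [blocked_succ hk ht, ih, Finset.sum_range_succ, add_div]
  rw [h, sum_freeRun, div_div, pow_succ, Nat.sub_sub, add_comm 1 t]

theorem visits_nonneg (m : ℕ → ℕ) (N T : ℕ) : 0 ≤ visits m N T :=
  Finset.sum_nonneg fun _ _ => freeRun_nonneg _ _ _ _

theorem visits_mono (m : ℕ → ℕ) {N N' : ℕ} (h : N ≤ N') (T : ℕ) :
    visits m N T ≤ visits m N' T :=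
  Finset.sum_le_sum_of_subset_of_nonneg (Finset.range_mono h) fun _ _ _ => freeRun_nonneg _ _ _ _

theorem visits_le_pow {m : ℕ → ℕ} {k t : ℕ} (hk : 1 ≤ k) (ht : m k = t + 1) (N : ℕ) :
    visits m N (t + 1) ≤ 2 ^ (t + 1) := by
  have h := blocked_eq_visits hk ht (N + (t + 1))
  rw [Nat.add_sub_cancel] at h
  have h1 := blocked_le_one m (N + (t + 1)) (t + 1)
  rw [h, div_le_one (by positivity)] at h1
  exact h1

theorem visits_le {m : ℕ → ℕ} {k t : ℕ} (hk : 1 ≤ k) (ht : m k = t + 1) (N : ℕ) :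
    visits m N (t + 1) ≤ N / 2 := by
  have h : visits m N (t + 1) ≤ ∑ _i ∈ Finset.range N, (1 / 2 : ℝ) := by
    refine Finset.sum_le_sum fun i _ => ?_
    rw [freeRun_succ_zero hk ht]
    have := blocked_nonneg m i (t + 1)
    linarith
  rw [Finset.sum_const, Finset.card_range, nsmul_eq_mul] at h
  linarith

/-- Up to time `2 ^ (t + 1)` there are at most `2 ^ (t + 1) / 2` expected visits, so blocking has
probability at most `1/2`; the next letter is `x` with probability `1/2`. -/
theorem quarter_le_freeRun {m : ℕ → ℕ} {k t : ℕ} (hk : 1 ≤ k) (ht : m k = t + 1) {n : ℕ}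
    (hn : n ≤ 2 ^ (t + 1)) : 1 / 4 ≤ freeRun m (n + 1) 0 (t + 1) := by
  rw [freeRun_succ_zero hk ht, blocked_eq_visits hk ht]
  have h1 := visits_le hk ht (n - (t + 1))
  have h2 : ((n - (t + 1) : ℕ) : ℝ) ≤ 2 ^ (t + 1) := by
    exact_mod_cast (Nat.sub_le _ _).trans hn
  have h3 : visits m (n - (t + 1)) (t + 1) / 2 ^ (t + 1) ≤ 1 / 2 := by
    rw [div_le_iff₀ (by positivity)]
    linarith
  linarith

theorem le_visits {m : ℕ → ℕ} {k t : ℕ} (hk : 1 ≤ k) (ht : m k = t + 1) (N : ℕ) :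
    min ((2 : ℝ) ^ (t + 1)) N / 4 ≤ visits m N (t + 1) := by
  have h1 : ∑ _i ∈ Finset.range (min (2 ^ (t + 1)) N), (1 / 4 : ℝ) ≤
      visits m (min (2 ^ (t + 1)) N) (t + 1) := by
    refine Finset.sum_le_sum fun i hi => quarter_le_freeRun hk ht ?_
    exact ((Finset.mem_range.1 hi).le).trans (min_le_left _ _)
  rw [Finset.sum_const, Finset.card_range, nsmul_eq_mul] at h1
  push_cast at h1
  have h2 := visits_mono m (min_le_right (2 ^ (t + 1)) N) (t + 1)
  linarith

/-! ### The exact formula for the expected length -/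

theorem avg_run (m : ℕ → ℕ) (n : ℕ) : avg m n (fun s => (s.run : ℝ)) = 1 - 1 / 2 ^ n := by
  induction n with
  | zero => simp [avg, init]
  | succ n ih =>
    rw [avg_succ]
    have h : (fun s : ReadState => (((stepX m s).run : ℝ) + (stepY s).run) / 2) =
        fun s => 1 / 2 * (s.run : ℝ) + 1 / 2 := by
      funext s
      rw [stepX_run]
      simp only [stepY]
      push_cast
      ring
    rw [h, avg_add, avg_const_mul, avg_const, ih, pow_succ]
    field_simp
    ring

/-- Only the word `y ^ n` contains no `x`. The constant `c` is free because each induction step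
shifts it by one. -/
theorem avg_run_of_not_started (m : ℕ → ℕ) (n : ℕ) (c : ℝ) :
    avg m n (fun s => if s.started = false then (s.run : ℝ) + c else 0) = (n + c) / 2 ^ n := by
  induction n generalizing c with
  | zero => simp [avg, init]
  | succ n ih =>
    rw [avg_succ]
    have h : (fun s : ReadState =>
        ((if (stepX m s).started = false then ((stepX m s).run : ℝ) + c else 0) +
          (if (stepY s).started = false then ((stepY s).run : ℝ) + c else 0)) / 2) =
        fun s => 1 / 2 * (if s.started = false then (s.run : ℝ) + (c + 1) else 0) := by
      funext s
      rw [stepX_started]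
      simp only [stepY]
      push_cast
      split_ifs <;> first | contradiction | ring
    rw [h, avg_const_mul, ih, pow_succ]
    push_cast
    field_simp
    ring

/-- The middle term is the first `x`, read after `n` letters `y`; the last sum comes from later `x`s
closing a run that is not erased. -/
theorem avg_kept_succ (m next : ℕ → ℕ) (hnext : ∀ j t, 1 ≤ j → (Prec m j t ↔ next j ≤ t)) (n : ℕ) :
    avg m (n + 1) (fun s => (s.kept : ℝ)) = avg m n (fun s => (s.kept : ℝ)) +
      (n + 1) / 2 ^ (n + 1) + (∑ j ∈ Finset.Icc 1 n, (j + 1) * freeRun m n j (next j)) / 2 := by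
  have h1 := avg_run_of_not_started m n 1
  have h2 : ∑ j ∈ Finset.Icc 1 n, (j + 1) * freeRun m n j (next j) =
      avg m n fun s => ∑ j ∈ Finset.Icc 1 n, ((j : ℝ) + 1) *
        if s.started = true ∧ s.run = j ∧ s.top < next j then 1 else 0 := by
    rw [avg_sum]
    exact Finset.sum_congr rfl fun j _ => (avg_const_mul _ _ _ _).symm
  rw [pow_succ, ← div_div, ← h1, h2, div_eq_inv_mul, div_eq_inv_mul, ← avg_const_mul,
    ← avg_const_mul, ← avg_add, ← avg_add, avg_succ]
  refine avg_congr m n fun s hs => ?_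
  have h3 : ∑ j ∈ Finset.Icc 1 n, ((j : ℝ) + 1) *
      (if s.started = true ∧ s.run = j ∧ s.top < next j then 1 else 0) =
      if s.started = true ∧ 1 ≤ s.run ∧ s.top < next s.run then (s.run : ℝ) + 1 else 0 := by
    by_cases h0 : 1 ≤ s.run
    · rw [Finset.sum_eq_single_of_mem s.run (Finset.mem_Icc.2 ⟨h0, hs⟩)]
      · simp [h0]
      · intro j _ hj
        rw [if_neg (fun h => hj h.2.1.symm), mul_zero]
    · rw [if_neg (fun h => h0 h.2.1)]
      refine Finset.sum_eq_zero fun j hj => ?_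
      rw [if_neg, mul_zero]
      rintro ⟨-, rfl, -⟩
      exact h0 (Finset.mem_Icc.1 hj).1
  rw [h3]
  simp only [stepY]
  unfold stepX
  by_cases hst : s.started = false
  · simp [hst]
    ring
  · rw [if_neg hst, if_neg hst, Bool.not_eq_false] at *
    simp only [hst, true_and]
    by_cases h0 : 1 ≤ s.run
    · have h0' : s.run ≠ 0 := by omega
      rw [hnext _ _ h0]
      simp only [h0', h0, false_or, true_and]
      split_ifs with h5 h6 h6
      · omega
      · simp
      · push_cast; ring
      · omega
    · have h0' : s.run = 0 := by omega
      simp [h0']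

theorem avg_size (m next : ℕ → ℕ) (hnext : ∀ j t, 1 ≤ j → (Prec m j t ↔ next j ≤ t)) (n : ℕ) :
    avg m n (fun s => (s.size : ℝ)) = 3 - (n + 3) / 2 ^ n +
      ∑ j ∈ Finset.Icc 1 n, ((j : ℝ) + 1) / 2 ^ (j + 1) * visits m (n - 1 - j) (next j) := by
  have h1 : avg m n (fun s => (s.kept : ℝ)) = 2 - (n + 2) / 2 ^ n +
      (∑ i ∈ Finset.range n, ∑ j ∈ Finset.Icc 1 i, ((j : ℝ) + 1) * freeRun m i j (next j)) / 2 := by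
    induction n with
    | zero => simp [avg, init]
    | succ n ih =>
      rw [avg_kept_succ m next hnext, ih, Finset.sum_range_succ, pow_succ]
      push_cast
      field_simp
      ring
  have h2 : ∑ i ∈ Finset.range n, ∑ j ∈ Finset.Icc 1 i, ((j : ℝ) + 1) * freeRun m i j (next j) =
      ∑ j ∈ Finset.Icc 1 n, ∑ i ∈ Finset.range n, ((j : ℝ) + 1) * freeRun m i j (next j) := by
    rw [Finset.sum_comm]
    refine Finset.sum_congr rfl fun i hi => ?_
    refine Finset.sum_subset (Finset.Icc_subset_Icc_right (Finset.mem_range.1 hi).le) ?_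
    intro j h3 h4
    rw [freeRun_of_le m, mul_zero]
    rw [Finset.mem_Icc] at h3 h4
    omega
  have h3 : (fun s : ReadState => (s.size : ℝ)) = fun s => (s.kept : ℝ) + s.run := by
    funext s; simp [size]
  rw [h3, avg_add, avg_run, h1, h2, Finset.sum_div]
  have h4 : ∑ j ∈ Finset.Icc 1 n, (∑ i ∈ Finset.range n,
      ((j : ℝ) + 1) * freeRun m i j (next j)) / 2 =
      ∑ j ∈ Finset.Icc 1 n, ((j : ℝ) + 1) / 2 ^ (j + 1) * visits m (n - 1 - j) (next j) := by
    refine Finset.sum_congr rfl fun j _ => ?_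
    rw [← Finset.mul_sum, sum_freeRun, pow_succ]
    ring
  rw [h4]
  ring

end Sm

/-! ### From uniform words to the random walk -/

namespace Sm

open ReadState

/-- The two letters, indexed by the booleans. -/
def letterOf : Bool → Letter
  | true => Letter.x
  | false => Letter.y

/-- The element of `S_m` spelled by a word. -/
def ofWord (m : ℕ → ℕ) {n : ℕ} (v : Fin n → Bool) : Sm m :=
  (List.ofFn fun i => gen m (letterOf (v i))).prod

theorem ofWord_snoc (m : ℕ → ℕ) {n : ℕ} (v : Fin n → Bool) (b : Bool) :
    ofWord m (Fin.snoc v b : Fin (n + 1) → Bool) = ofWord m v * gen m (letterOf b) := by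
  rw [ofWord, List.ofFn_succ', List.concat_eq_append, List.prod_append, List.prod_singleton]
  simp only [Fin.snoc_castSucc, Fin.snoc_last]
  rfl

theorem sum_words_eq_avg (m : ℕ → ℕ) (n : ℕ) (g : ReadState → ℝ) :
    ∑ v : Fin n → Bool, (1 / 2 : ℝ) ^ n * g (state m (ofWord m v)) = avg m n g := by
  induction n generalizing g with
  | zero => simp [ofWord, state_one, avg]
  | succ n ih =>
    rw [avg_succ, ← ih, ← (Fin.snocEquiv fun _ => Bool).sum_comp, Fintype.sum_prod_type_right]
    refine Finset.sum_congr rfl fun v _ => ?_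
    rw [Fintype.sum_bool]
    change (1 / 2 : ℝ) ^ (n + 1) * g (state m (ofWord m (Fin.snoc v true : Fin (n + 1) → Bool))) +
      (1 / 2 : ℝ) ^ (n + 1) * g (state m (ofWord m (Fin.snoc v false : Fin (n + 1) → Bool))) = _
    rw [ofWord_snoc, ofWord_snoc, state_mul_gen, state_mul_gen, pow_succ]
    change _ * g (stepX m _) + _ * g (stepY _) = _
    ring

theorem uniformOn_gens_gen (m : ℕ → ℕ) (b : Bool) :
    uniformOn (gens m) {gen m (letterOf b)} = 2⁻¹ := by
  classical
  have : MeasurableSingletonClass (Sm m) := ⟨fun _ => trivial⟩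
  have h1 : gens m = (({x m, y m} : Finset (Sm m)) : Set (Sm m)) := by simp [gens]
  have h2 : ({gen m (letterOf b)} : Set (Sm m)) =
      (({gen m (letterOf b)} : Finset (Sm m)) : Set (Sm m)) := by simp
  have h3 : gen m (letterOf b) ∈ ({x m, y m} : Finset (Sm m)) := by
    cases b
    · exact Finset.mem_insert_of_mem (Finset.mem_singleton_self _)
    · exact Finset.mem_insert_self _ _
  rw [h1, h2, uniformOn_apply_finset, Finset.inter_singleton_of_mem h3,
    Finset.card_pair (x_ne_y m), Finset.card_singleton]
  norm_num

theorem gen_letterOf_injective (m : ℕ → ℕ) : Function.Injective fun b => gen m (letterOf b) := by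
  intro a b h
  cases a <;> cases b
  · rfl
  · exact absurd h.symm (x_ne_y m)
  · exact absurd h (x_ne_y m)
  · rfl

/-- Almost surely the steps lie in the generating set, so the `2 ^ n` cylinder events `A v`
partition the space up to a null set. By independence each has mass `2 ^ (-n)`, where `x ≠ y` gives
each letter mass `1/2`. -/
theorem integral_walk (m : ℕ → ℕ) {Ω : Type*} [MeasurableSpace Ω] (μ : Measure Ω)
    [IsProbabilityMeasure μ] (R : ℕ → Ω → Sm m) (hR : IsSimpleRandomWalk (gens m) μ R) (n : ℕ)
    (g : ReadState → ℝ) :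
    Integrable (fun ω => g (state m (R n ω))) μ ∧
      ∫ ω, g (state m (R n ω)) ∂μ = avg m n g := by
  obtain ⟨X, hind, hlaw, hprod⟩ := hR
  let A : (Fin n → Bool) → Set Ω := fun v =>
    ⋂ i : Fin n, X i ⁻¹' {gen m (letterOf (v i))}
  have hA : ∀ v, NullMeasurableSet (A v) μ := fun v =>
    NullMeasurableSet.iInter fun i => (hlaw i).aemeasurable.nullMeasurable trivial
  have hμ : ∀ v, μ (A v) = 2⁻¹ ^ n := fun v => by
    have h := (hind.precomp (g := fun i : Fin n => (i : ℕ)) Fin.val_injective).meas_iInter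
      (s := fun i : Fin n => X i ⁻¹' {gen m (letterOf (v i))}) fun i => ⟨_, trivial, rfl⟩
    rw [h]
    have h2 : ∀ i : Fin n, μ (X i ⁻¹' {gen m (letterOf (v i))}) = 2⁻¹ := fun i => by
      rw [← uniformOn_gens_gen m (v i), ← (hlaw i).map_eq,
        Measure.map_apply_of_aemeasurable (hlaw i).aemeasurable trivial]
    simp [h2]
  have hae : ∀ᵐ ω ∂μ, ∀ i, X i ω ∈ gens m := by
    rw [ae_all_iff]
    intro i
    refine ae_of_ae_map (hlaw i).aemeasurable ?_
    rw [(hlaw i).map_eq]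
    exact ae_cond_mem trivial
  have hsum : (fun ω => g (state m (R n ω))) =ᵐ[μ]
      fun ω => ∑ v, (A v).indicator (fun _ => g (state m (ofWord m v))) ω := by
    filter_upwards [hae] with ω hω
    have h1 : ∀ i, ∃ b, X i ω = gen m (letterOf b) := fun i => by
      rcases hω i with h | h
      · exact ⟨true, h⟩
      · exact ⟨false, h⟩
    choose b hb using h1
    rw [Finset.sum_eq_single_of_mem (fun i : Fin n => b i) (Finset.mem_univ _)]
    · have hmem : ω ∈ A fun i : Fin n => b i := Set.mem_iInter.2 fun i => hb i
      rw [Set.indicator_of_mem hmem, hprod]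
      congr 3
      refine List.ext_getElem (by simp) fun i _ _ => ?_
      simp [hb]
    · intro v _ hv
      refine Set.indicator_of_notMem (fun h => hv ?_) _
      funext i
      exact gen_letterOf_injective m ((Set.mem_iInter.1 h i).symm.trans (hb i))
  have hint : ∀ v, Integrable ((A v).indicator fun _ => g (state m (ofWord m v))) μ := fun v =>
    (integrable_const _).integrableOn.integrable_indicator₀ (hA v)
  refine ⟨(integrable_finsetSum _ fun v _ => hint v).congr hsum.symm, ?_⟩
  rw [integral_congr_ae hsum, integral_finsetSum _ fun v _ => hint v, ← sum_words_eq_avg]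
  refine Finset.sum_congr rfl fun v _ => ?_
  rw [integral_indicator₀ (hA v), setIntegral_const, Measure.real, hμ]
  simp

end Sm

/-! ### Levels of the sequence and elementary series -/

theorem le_of_one_le_of_le {m : ℕ → ℕ} (hm : ∀ k, 1 ≤ k → m k < m (k + 1)) {a b : ℕ} (ha : 1 ≤ a)
    (hab : a ≤ b) : m a ≤ m b := by
  induction b, hab using Nat.le_induction with
  | base => exact le_rfl
  | succ b hab ih => exact ih.trans (hm b (ha.trans hab)).le

theorem exists_level {m : ℕ → ℕ} (hm1 : m 1 = 1) (hm : ∀ k, 1 ≤ k → m k < m (k + 1)) {j : ℕ}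
    (hj : 1 ≤ j) : ∃ k, 1 ≤ k ∧ m k ≤ j ∧ j < m (k + 1) := by
  induction j, hj using Nat.le_induction with
  | base => exact ⟨1, le_rfl, hm1.le, by have := hm 1 le_rfl; omega⟩
  | succ j hj ih =>
    obtain ⟨k, hk, h1, h2⟩ := ih
    rcases Nat.lt_or_ge (j + 1) (m (k + 1)) with h | h
    · exact ⟨k, hk, by omega, h⟩
    · exact ⟨k + 1, by omega, h, by have := hm (k + 1) (by omega); omega⟩

theorem prec_iff_of_level {m : ℕ → ℕ} (hm : ∀ k, 1 ≤ k → m k < m (k + 1)) {j k : ℕ}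
    (h1 : m k ≤ j) (h2 : j < m (k + 1)) (t : ℕ) : Prec m j t ↔ m (k + 1) ≤ t := by
  constructor
  · rintro ⟨k', hk', h3, h4⟩
    have h5 : k + 1 ≤ k' := by
      by_contra h
      have := le_of_one_le_of_le hm hk' (show k' ≤ k by omega)
      omega
    exact (le_of_one_le_of_le hm (by omega) h5).trans h4
  · exact fun h => ⟨k + 1, by omega, h2, h⟩

theorem sum_Ico_succ_div_two_pow {a b : ℕ} (hab : a ≤ b) :
    ∑ j ∈ Finset.Ico a b, ((j : ℝ) + 1) / 2 ^ (j + 1) = (a + 2) / 2 ^ a - (b + 2) / 2 ^ b := by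
  induction b, hab using Nat.le_induction with
  | base => simp
  | succ b hab ih =>
    rw [Finset.sum_Ico_succ_top hab, ih, pow_succ]
    push_cast
    field_simp
    ring

/-- `11/8` is the full series. It bounds the error of the lower estimate and is matched there by `3
- 13/8`. -/
theorem sum_Icc_sq_div_two_pow_le (n : ℕ) :
    ∑ j ∈ Finset.Icc 1 n, ((j : ℝ) + 1) ^ 2 / 2 ^ (j + 3) ≤ 11 / 8 := by
  have h : ∑ j ∈ Finset.Icc 1 n, ((j : ℝ) + 1) ^ 2 / 2 ^ (j + 3) =
      11 / 8 - ((n : ℝ) ^ 2 + 6 * n + 11) / 2 ^ (n + 3) := by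
    induction n with
    | zero => norm_num
    | succ n ih =>
      rw [Finset.sum_Icc_succ_top (by omega), ih]
      push_cast
      simp only [pow_succ]
      field_simp
      ring
  rw [h]
  have : (0 : ℝ) ≤ ((n : ℝ) ^ 2 + 6 * n + 11) / 2 ^ (n + 3) := by positivity
  linarith

theorem sum_smallIndices_le {m : ℕ → ℕ} (hm1 : m 1 = 1) (hm : ∀ k, 1 ≤ k → m k < m (k + 1)) (n : ℕ)
    {f : ℕ → ℝ} (hf : ∀ j, 0 ≤ f j) :
    ∑ k ∈ smallIndices m n, f (m k) ≤ ∑ j ∈ Finset.Icc 1 n, f j := by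
  have hinj : Set.InjOn m (smallIndices m n) := by
    have key : ∀ a b, 1 ≤ a → a < b → m a < m b := fun a b ha hab =>
      (hm a ha).trans_le (le_of_one_le_of_le hm (by omega) hab)
    intro a ha b hb hab
    have ha := ((mem_smallIndices hm1 hm n a).1 ha).1
    have hb := ((mem_smallIndices hm1 hm n b).1 hb).1
    rcases lt_trichotomy a b with h | h | h
    · have := key a b ha h; omega
    · exact h
    · have := key b a hb h; omega
  rw [← Finset.sum_image hinj]
  refine Finset.sum_le_sum_of_subset_of_nonneg ?_ fun j _ _ => hf j
  intro j hj
  obtain ⟨k, hk, rfl⟩ := Finset.mem_image.1 hj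
  obtain ⟨h1, h2⟩ := (mem_smallIndices hm1 hm n k).1 hk
  have := le_of_one_le_of_le hm le_rfl h1
  exact Finset.mem_Icc.2 ⟨by omega, by omega⟩

/-- The blocks between consecutive `m k` partition the positive integers. Every `j ≤ n - 2` lies in
a block with `m k ≤ n - 2`; a block may overshoot `n`, which is harmless for nonnegative terms. -/
theorem sum_le_sum_levels {m : ℕ → ℕ} (hm1 : m 1 = 1) (hm : ∀ k, 1 ≤ k → m k < m (k + 1)) (n : ℕ)
    {f : ℕ → ℝ} (hf : ∀ j, 0 ≤ f j) (h0 : ∀ j, n < j + 2 → f j = 0) :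
    ∑ j ∈ Finset.Icc 1 n, f j ≤
      ∑ k ∈ smallIndices m n, ∑ j ∈ Finset.Ico (m k) (m (k + 1)), f j := by
  have hdisj : (smallIndices m n : Set ℕ).PairwiseDisjoint
      fun k => Finset.Ico (m k) (m (k + 1)) := by
    intro a ha b hb hab
    have ha := ((mem_smallIndices hm1 hm n a).1 ha).1
    have hb := ((mem_smallIndices hm1 hm n b).1 hb).1
    refine Finset.disjoint_left.2 fun j h1 h2 => ?_
    rw [Finset.mem_Ico] at h1 h2
    rcases Nat.lt_or_gt_of_ne hab with h | h
    · have := le_of_one_le_of_le hm (by omega) (show a + 1 ≤ b from h)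
      omega
    · have := le_of_one_le_of_le hm (by omega) (show b + 1 ≤ a from h)
      omega
  rw [← Finset.sum_biUnion hdisj, ← Finset.sum_filter_of_ne (p := fun j => j + 2 ≤ n)]
  · refine Finset.sum_le_sum_of_subset_of_nonneg ?_ fun j _ _ => hf j
    intro j hj
    obtain ⟨h1, h2⟩ := Finset.mem_filter.1 hj
    obtain ⟨k, hk, h3, h4⟩ := exists_level hm1 hm (Finset.mem_Icc.1 h1).1
    exact Finset.mem_biUnion.2 ⟨k, (mem_smallIndices hm1 hm n k).2 ⟨hk, by omega⟩,
      Finset.mem_Ico.2 ⟨h3, h4⟩⟩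
  · intro j _ hj
    by_contra h
    exact hj (h0 j (by omega))

/-- For `j ≥ 1`, `next j` is the first `m k` beyond `j`, which turns `≺` into a single comparison.
Its value at `0` is arbitrary. -/
theorem exists_next {m : ℕ → ℕ} (hm1 : m 1 = 1) (hm : ∀ k, 1 ≤ k → m k < m (k + 1)) :
    ∃ next : ℕ → ℕ, (∀ j t, 1 ≤ j → (Prec m j t ↔ next j ≤ t)) ∧
      ∀ k j, m k ≤ j → j < m (k + 1) → 1 ≤ j → next j = m (k + 1) := by
  have h : ∀ j, ∃ N, 1 ≤ j → ∀ t, Prec m j t ↔ N ≤ t := fun j => by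
    by_cases hj : 1 ≤ j
    · obtain ⟨k, -, h1, h2⟩ := exists_level hm1 hm hj
      exact ⟨m (k + 1), fun _ => prec_iff_of_level hm h1 h2⟩
    · exact ⟨0, fun h => absurd h hj⟩
  choose next hnext using h
  refine ⟨next, fun j t hj => hnext j hj t, fun k j h1 h2 hj => eq_of_forall_ge_iff fun t => ?_⟩
  rw [← hnext j hj, prec_iff_of_level hm h1 h2]

/-! ### The two bounds -/

theorem mainTheorem7 (m : ℕ → ℕ) (hm1 : m 1 = 1) (hm : ∀ k, 1 ≤ k → m k < m (k + 1))
    {Ω : Type*} [MeasurableSpace Ω] (μ : Measure Ω) [IsProbabilityMeasure μ]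
    (R : ℕ → Ω → Sm m) (hR : IsSimpleRandomWalk (Sm.gens m) μ R) (n : ℕ) :
    Integrable (fun ω => (wordLength (Sm.gens m) (R n ω) : ℝ)) μ ∧
    ∑ k ∈ smallIndices m n, ((m k : ℝ) + 1) / 2 ^ (m k + 3) * min ((2 : ℝ) ^ m (k + 1)) (n : ℝ)
      ≤ ∫ ω, (wordLength (Sm.gens m) (R n ω) : ℝ) ∂μ ∧
    ∫ ω, (wordLength (Sm.gens m) (R n ω) : ℝ) ∂μ
      ≤ ∑ k ∈ smallIndices m n,
          ((m k : ℝ) + 2) / 2 ^ m k * min ((2 : ℝ) ^ m (k + 1)) (n : ℝ) + 3 := by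
  obtain ⟨hint, hval⟩ := Sm.integral_walk m μ R hR n fun s => (s.size : ℝ)
  obtain ⟨next, hprec, hnext⟩ := exists_next hm1 hm
  simp only [Sm.wordLength_eq_size]
  refine ⟨hint, ?_⟩
  rw [hval, Sm.avg_size m next hprec]
  set f : ℕ → ℝ := fun j => ((j : ℝ) + 1) / 2 ^ (j + 1) * Sm.visits m (n - 1 - j) (next j) with hfdef
  have hf : ∀ j, 0 ≤ f j := fun j => mul_nonneg (by positivity) (Sm.visits_nonneg _ _ _)
  have hlev : ∀ k ∈ smallIndices m n, 1 ≤ k ∧ 1 ≤ m k ∧ m k + 2 ≤ n := fun k hk => by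
    obtain ⟨h1, h2⟩ := (mem_smallIndices hm1 hm n k).1 hk
    have := le_of_one_le_of_le hm le_rfl h1
    exact ⟨h1, by omega, h2⟩
  have hsucc : ∀ k, 1 ≤ k → ∃ t, m (k + 1) = t + 1 := fun k hk =>
    ⟨m (k + 1) - 1, by have := hm k hk; omega⟩
  constructor
  -- For `n < 2` the term `3 - (n + 3) / 2 ^ n` is less than `11/8`, but the sum to be bounded is
  -- empty.
  · rcases Nat.lt_or_ge n 2 with hn | hn
    · have hempty : smallIndices m n = ∅ := by
        refine Finset.eq_empty_of_forall_notMem fun k hk => ?_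
        have := hlev k hk
        omega
      rw [hempty, Finset.sum_empty, ← Sm.avg_size m next hprec, ← Sm.avg_const m n 0]
      exact Sm.avg_mono m n fun s => Nat.cast_nonneg _
    · have h1 := sum_smallIndices_le hm1 hm n hf
      have h2 := (sum_smallIndices_le hm1 hm n
        (f := fun j => ((j : ℝ) + 1) ^ 2 / 2 ^ (j + 3)) fun j => by positivity).trans
        (sum_Icc_sq_div_two_pow_le n)
      have h3 : ∑ k ∈ smallIndices m n,
          ((m k : ℝ) + 1) / 2 ^ (m k + 3) * min ((2 : ℝ) ^ m (k + 1)) (n : ℝ) ≤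
          ∑ k ∈ smallIndices m n, (f (m k) + ((m k : ℝ) + 1) ^ 2 / 2 ^ (m k + 3)) := by
        refine Finset.sum_le_sum fun k hk => ?_
        obtain ⟨hk1, hk2, hk3⟩ := hlev k hk
        obtain ⟨t, ht⟩ := hsucc k hk1
        simp only [hfdef]
        rw [hnext k (m k) le_rfl (hm k hk1) hk2, ht]
        have h4 := Sm.le_visits (m := m) (show 1 ≤ k + 1 by omega) ht (n - 1 - m k)
        -- Replacing `n` by `n - 1 - m k` lowers the minimum by at most `m k + 1`; with its weight,
        -- this loss is a term of the series bounded by `11/8`.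
        have h5 : min ((2 : ℝ) ^ (t + 1)) n ≤
            min ((2 : ℝ) ^ (t + 1)) ((n - 1 - m k : ℕ) : ℝ) + (m k + 1) := by
          have h6 : (n : ℝ) = ((n - 1 - m k : ℕ) : ℝ) + (m k + 1) := by
            norm_cast; omega
          rw [← min_add_add_right, ← h6]
          refine min_le_min_right _ ?_
          have : (0 : ℝ) ≤ m k := Nat.cast_nonneg _
          linarith
        have h7 : min ((2 : ℝ) ^ (t + 1)) n ≤
            4 * Sm.visits m (n - 1 - m k) (t + 1) + (m k + 1) := by linarith
        calc _ ≤ ((m k : ℝ) + 1) / 2 ^ (m k + 3) *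
              (4 * Sm.visits m (n - 1 - m k) (t + 1) + (m k + 1)) := by gcongr
          _ = _ := by
            simp only [pow_succ]
            field_simp
            ring
      rw [Finset.sum_add_distrib] at h3
      have h8 : ((n : ℝ) + 3) / 2 ^ n ≤ 13 / 8 := by
        rw [div_le_iff₀ (by positivity)]
        have h9 : 8 * (n + 3) ≤ 13 * 2 ^ n := by
          clear * - hn
          induction n, hn using Nat.le_induction with
          | base => norm_num
          | succ n hn ih => rw [pow_succ]; omega
        have h9' : 8 * ((n : ℝ) + 3) ≤ 13 * 2 ^ n := by exact_mod_cast h9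
        linarith
      linarith
  · have h0 : ∀ j, n < j + 2 → f j = 0 := fun j hj => by
      simp only [hfdef]
      rw [show n - 1 - j = 0 by omega, Sm.visits, Finset.sum_range_zero, mul_zero]
    have h1 := sum_le_sum_levels hm1 hm n hf h0
    have h2 : ∑ k ∈ smallIndices m n, ∑ j ∈ Finset.Ico (m k) (m (k + 1)), f j ≤
        ∑ k ∈ smallIndices m n,
          ((m k : ℝ) + 2) / 2 ^ m k * min ((2 : ℝ) ^ m (k + 1)) (n : ℝ) := by
      refine Finset.sum_le_sum fun k hk => ?_
      obtain ⟨hk1, hk2, -⟩ := hlev k hk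
      obtain ⟨t, ht⟩ := hsucc k hk1
      have h3 : ∑ j ∈ Finset.Ico (m k) (m (k + 1)), f j ≤
          ∑ j ∈ Finset.Ico (m k) (m (k + 1)),
            ((j : ℝ) + 1) / 2 ^ (j + 1) * min ((2 : ℝ) ^ m (k + 1)) (n : ℝ) := by
        refine Finset.sum_le_sum fun j hj => ?_
        rw [Finset.mem_Ico] at hj
        simp only [hfdef]
        rw [hnext k j hj.1 hj.2 (by omega), ht]
        refine mul_le_mul_of_nonneg_left (le_min ?_ ?_) (by positivity)
        · exact Sm.visits_le_pow (show 1 ≤ k + 1 by omega) ht _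
        · refine (Sm.visits_le (show 1 ≤ k + 1 by omega) ht _).trans ?_
          have h4 : ((n - 1 - j : ℕ) : ℝ) ≤ n := by norm_cast; omega
          have : (0 : ℝ) ≤ n := Nat.cast_nonneg _
          linarith
      refine h3.trans ?_
      -- The weights in a block telescope, and the subtracted endpoint term is dropped.
      rw [← Finset.sum_mul, sum_Ico_succ_div_two_pow (hm k hk1).le]
      refine mul_le_mul_of_nonneg_right ?_ (by positivity)
      have : (0 : ℝ) ≤ ((m (k + 1) : ℝ) + 2) / 2 ^ m (k + 1) := by positivity
      linarith
    have h5 : (0 : ℝ) ≤ ((n : ℝ) + 3) / 2 ^ n := by positivity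
    linarith
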